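/- Let $d\ge 1$, $m\ge 0$ and let $X_1,\dots,X_m\in M_d(\mathbb{C})$. For $\mathbb{K}\in\{\mathbb{R},\mathbb{C}\}$ let $\mathrm{Alg}_{\mathbb{K}}(X_j\colon j)$ denote the unital $*$-algebra over $\mathbb{K}$ generated by $X_1,\dots,X_m$ in $M_d(\mathbb{C})$, where the involution is the conjugate transpose. Assume that $X_1,\dots,X_m$ is irreducible, i.e. $\mathrm{Alg}_{\mathbb{C}}(X_j\colon j)=M_d(\mathbb{C})$. Write $\mathrm{U}_d(\mathbb{C})$ for the group of unitary $d\times d$ matrices, $\overline{X}$ for the entrywise complex conjugate of $X$, and $I$ for the identity matrix. Consider the following statements: 1. there is $U\in \mathrm{U}_d(\mathbb{C})$ such that $UX_jU^*\in M_d(\mathbb{R})$ for all $j=1,\dots,m$; 2. there is $U\in \mathrm{U}_d(\mathbb{C})$ such that $UX_jU^*=\overline{X_j}$ for all $j=1,\dots,m$; 3. $\operatorname{Tr} X\in\mathbb{R}$ for every finite product $X$ of the matrices $X_1,\dots,X_m,X_1^*,\dots,X_m^*$ (so of $X_1,\dots,X_m$ if these are hermitian); 4. $\mathrm{Alg}_{\mathbb{R}}(X_j\colon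 j)\cap\mathbb{C}I=\mathbb{R}I$; 5. $\mathrm{Alg}_{\mathbb{R}}(X_j\colon j)\neq M_d(\mathbb{C})$. Then (1)$\Rightarrow$(2)$\Leftrightarrow$(3)$\Leftrightarrow$(4)$\Leftrightarrow$(5). If moreover $d$ is odd, or $d=2$ and all $X_j$ are hermitian, or $d\in\{4,6\}$, $m\le 3$ and all $X_j$ are (orthogonal) projections, i.e. $X_j=X_j^*=X_j^2$, then (1)$\Leftrightarrow$(2)$\Leftrightarrow$(3)$\Leftrightarrow$(4)$\Leftrightarrow$(5). -/

import Mathlib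

open Matrix

/-- The real unital `*`-algebra generated by the matrices `X j` inside `M_d(ℂ)`; the involution is
the conjugate transpose. -/
noncomputable def realStarAlg {d m : ℕ} (X : Fin m → Matrix (Fin d) (Fin d) ℂ) :
    StarSubalgebra ℝ (Matrix (Fin d) (Fin d) ℂ) :=
  StarAlgebra.adjoin ℝ (Set.range X)

/-- The complex unital `*`-algebra generated by the matrices `X j` inside `M_d(ℂ)`. -/
noncomputable def complexStarAlg {d m : ℕ} (X : Fin m → Matrix (Fin d) (Fin d) ℂ) :
    StarSubalgebra ℂ (Matrix (Fin d) (Fin d) ℂ) :=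
  StarAlgebra.adjoin ℂ (Set.range X)

/-- The collection `X` generates all of `M_d(ℂ)` as a complex unital `*`-algebra. -/
def IsIrreducibleCollection {d m : ℕ} (X : Fin m → Matrix (Fin d) (Fin d) ℂ) : Prop :=
  complexStarAlg X = ⊤

/-- A single unitary conjugates every `X j` to a matrix with real entries. -/
def IsUnitarilyReal {d m : ℕ} (X : Fin m → Matrix (Fin d) (Fin d) ℂ) : Prop :=
  ∃ U ∈ Matrix.unitaryGroup (Fin d) ℂ, ∀ j, ∃ R : Matrix (Fin d) (Fin d) ℝ,
    U * X j * Uᴴ = R.map (fun r : ℝ => (r : ℂ))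

/-- A single unitary conjugates every `X j` to its entrywise complex conjugate. -/
def IsUnitarilySelfConj {d m : ℕ} (X : Fin m → Matrix (Fin d) (Fin d) ℂ) : Prop :=
  ∃ U ∈ Matrix.unitaryGroup (Fin d) ℂ, ∀ j, U * X j * Uᴴ = (X j).map (starRingEnd ℂ)

/-- Every finite product whose factors are taken among the `X j` and their conjugate transposes
has real trace. -/
def HasRealTraces {d m : ℕ} (X : Fin m → Matrix (Fin d) (Fin d) ℂ) : Prop :=
  ∀ L : List (Matrix (Fin d) (Fin d) ℂ), (∀ A ∈ L, ∃ j, A = X j ∨ A = (X j)ᴴ) →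
    ∃ r : ℝ, Matrix.trace L.prod = (r : ℂ)

/-- The real `*`-algebra generated by `X` meets `ℂ I` exactly in `ℝ I`. -/
def HasOnlyRealScalars {d m : ℕ} (X : Fin m → Matrix (Fin d) (Fin d) ℂ) : Prop :=
  (realStarAlg X : Set (Matrix (Fin d) (Fin d) ℂ)) ∩
      Set.range (fun z : ℂ => z • (1 : Matrix (Fin d) (Fin d) ℂ)) =
    Set.range (fun r : ℝ => r • (1 : Matrix (Fin d) (Fin d) ℂ))

/-! Write `A` for the real algebra and bars for entrywise conjugation. The implications
(1)⇒(2)⇒(3)⇒(4)⇒(5) are direct, by traces of words and scalars. For (5)⇒(2), irreducibility gives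
`M_d(ℂ) = A + iA`, so `A ∩ iA` is a two-sided ideal of a simple ring. It vanishes unless `A` is
everything. Hence `M_d(ℂ) = A ⊕ iA`, and conjugation on `A` extends to a complex algebra
endomorphism, which is inner (`exists_isUnit_forall_mul_eq`). Schur's lemma rescales the
implementing matrix to a unitary `U`.

For (2)⇒(1), Schur's lemma applied to `Ū U` gives `Uᵀ = ±U` (`transpose_eq_or_eq_neg`). If `U` is
symmetric, a polar decomposition of `t + U` produces the real form. The extra hypotheses serve only
to exclude an antisymmetric `U`. Oddness of `d` does so by determinants. For `d = 2`, hermitian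
matrices would have to be scalar.

For projections, `U` defines a symplectic form `ω` for which every `X j` is self-adjoint and hence
has even rank. When `d ≤ 6`, each may be replaced by its complement so that its rank is at most two.
Three such projections share a nonzero invariant subspace of dimension at most three
(`hasSmallInvariantSubspace`), which contradicts irreducibility because `d ≥ 4`. -/

/-! ### Entrywise conjugation and the equivalence of (2)–(5) -/

section Conj

variable {d m : ℕ}

/-- Entrywise complex conjugation of square matrices. -/
noncomputable def entryConj (d : ℕ) :
    Matrix (Fin d) (Fin d) ℂ →+* Matrix (Fin d) (Fin d) ℂ :=
  (starRingEnd ℂ).mapMatrix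

theorem map_starRingEnd_eq_entryConj (A : Matrix (Fin d) (Fin d) ℂ) :
    A.map (starRingEnd ℂ) = entryConj d A := rfl

theorem entryConj_entryConj (A : Matrix (Fin d) (Fin d) ℂ) :
    entryConj d (entryConj d A) = A := by
  ext i j; simp [entryConj]

theorem entryConj_smul (z : ℂ) (A : Matrix (Fin d) (Fin d) ℂ) :
    entryConj d (z • A) = star z • entryConj d A := by
  ext i j; simp [entryConj]

theorem entryConj_real_smul (r : ℝ) (A : Matrix (Fin d) (Fin d) ℂ) :
    entryConj d (r • A) = r • entryConj d A := by
  ext i j; simp [entryConj]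

theorem entryConj_conjTranspose (A : Matrix (Fin d) (Fin d) ℂ) :
    entryConj d Aᴴ = (entryConj d A)ᴴ := by
  ext i j; simp [entryConj]

theorem entryConj_eq_transpose_conjTranspose (A : Matrix (Fin d) (Fin d) ℂ) :
    entryConj d A = Aᴴᵀ := by
  ext i j; simp [entryConj]

theorem trace_entryConj (A : Matrix (Fin d) (Fin d) ℂ) :
    (entryConj d A).trace = star A.trace := by
  simp [entryConj, Matrix.trace]

theorem entryConj_eq_self_iff (A : Matrix (Fin d) (Fin d) ℂ) :
    entryConj d A = A ↔ ∃ R : Matrix (Fin d) (Fin d) ℝ, A = R.map (fun r : ℝ => (r : ℂ)) := by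
  constructor
  · intro h
    refine ⟨A.map Complex.re, ?_⟩
    ext i j
    have := congrFun (congrFun h i) j
    simp only [entryConj, RingHom.mapMatrix_apply, map_apply] at this
    simpa using (Complex.conj_eq_iff_re.mp this).symm
  · rintro ⟨R, rfl⟩
    ext i j; simp [entryConj]

theorem conjTranspose_mul_self_of_mem_unitaryGroup {U : Matrix (Fin d) (Fin d) ℂ}
    (hU : U ∈ unitaryGroup (Fin d) ℂ) : Uᴴ * U = 1 := mem_unitaryGroup_iff'.mp hU

theorem self_mul_conjTranspose_of_mem_unitaryGroup {U : Matrix (Fin d) (Fin d) ℂ}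
    (hU : U ∈ unitaryGroup (Fin d) ℂ) : U * Uᴴ = 1 := mem_unitaryGroup_iff.mp hU

theorem entryConj_mem_unitaryGroup {U : Matrix (Fin d) (Fin d) ℂ}
    (hU : U ∈ unitaryGroup (Fin d) ℂ) : entryConj d U ∈ unitaryGroup (Fin d) ℂ := by
  rw [mem_unitaryGroup_iff, star_eq_conjTranspose, ← entryConj_conjTranspose, ← map_mul,
    self_mul_conjTranspose_of_mem_unitaryGroup hU, map_one]

theorem IsUnitarilyReal.isUnitarilySelfConj {X : Fin m → Matrix (Fin d) (Fin d) ℂ}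
    (h : IsUnitarilyReal X) : IsUnitarilySelfConj X := by
  obtain ⟨U, hU, h⟩ := h
  have hV := entryConj_mem_unitaryGroup hU
  -- Reality of `U X Uᴴ` reads `U X Uᴴ = Ū X̄ Ūᴴ`; solving for `X̄` gives the witness `Ūᴴ U`.
  refine ⟨(entryConj d U)ᴴ * U, mul_mem (Unitary.star_mem hV) hU, fun j => ?_⟩
  have h1 := (entryConj_eq_self_iff _).mpr (h j)
  rw [map_mul, map_mul, entryConj_conjTranspose] at h1
  rw [map_starRingEnd_eq_entryConj, conjTranspose_mul, conjTranspose_conjTranspose]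
  have h2 := conjTranspose_mul_self_of_mem_unitaryGroup hV
  calc (entryConj d U)ᴴ * U * X j * (Uᴴ * entryConj d U)
      = (entryConj d U)ᴴ * (U * X j * Uᴴ) * entryConj d U := by simp only [Matrix.mul_assoc]
    _ = ((entryConj d U)ᴴ * entryConj d U) * entryConj d (X j) *
          ((entryConj d U)ᴴ * entryConj d U) := by
        rw [← h1]; simp only [Matrix.mul_assoc]
    _ = entryConj d (X j) := by rw [h2]; simp

theorem IsUnitarilySelfConj.hasRealTraces {X : Fin m → Matrix (Fin d) (Fin d) ℂ}
    (h : IsUnitarilySelfConj X) : HasRealTraces X := by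
  obtain ⟨U, hU, h⟩ := h
  have hU' := conjTranspose_mul_self_of_mem_unitaryGroup hU
  have hU'' := self_mul_conjTranspose_of_mem_unitaryGroup hU
  intro L hL
  have key : U * L.prod * Uᴴ = entryConj d L.prod := by
    induction L with
    | nil => simp [hU'']
    | cons A L ih =>
      have hA : U * A * Uᴴ = entryConj d A := by
        obtain ⟨j, rfl | rfl⟩ := hL A (by simp)
        · exact h j
        · rw [entryConj_conjTranspose, ← map_starRingEnd_eq_entryConj, ← h j]
          simp [Matrix.mul_assoc]
      rw [List.prod_cons, map_mul, ← hA, ← ih fun B hB => hL B (by simp [hB])]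
      calc U * (A * L.prod) * Uᴴ = U * A * 1 * L.prod * Uᴴ := by simp [Matrix.mul_assoc]
        _ = _ := by rw [← hU']; simp only [Matrix.mul_assoc]
  have h1 : L.prod.trace = star L.prod.trace := by
    rw [← trace_entryConj, ← key, trace_mul_cycle, hU', one_mul]
  exact ⟨_, (Complex.conj_eq_iff_re.mp h1.symm).symm⟩

/-- The real algebra is the real span of the words in the generators and their adjoints, and the
trace is real-linear. -/
theorem trace_real_of_mem_realStarAlg {X : Fin m → Matrix (Fin d) (Fin d) ℂ}
    (h : HasRealTraces X) {A : Matrix (Fin d) (Fin d) ℂ} (hA : A ∈ realStarAlg X) :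
    ∃ r : ℝ, A.trace = r := by
  rw [realStarAlg, ← StarSubalgebra.mem_toSubalgebra, StarAlgebra.adjoin_toSubalgebra,
    ← Subalgebra.mem_toSubmodule, Algebra.adjoin_eq_span] at hA
  induction hA using Submodule.span_induction with
  | mem x hx =>
    obtain ⟨L, hL, rfl⟩ := Submonoid.exists_list_of_mem_closure hx
    refine h L fun A hA => ?_
    rcases hL A hA with ⟨j, rfl⟩ | ⟨j, hj⟩
    · exact ⟨j, .inl rfl⟩
    · exact ⟨j, .inr (by rw [hj]; simp [star_eq_conjTranspose])⟩
  | zero => exact ⟨0, by simp⟩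
  | add x y _ _ hx hy =>
    obtain ⟨r, hr⟩ := hx
    obtain ⟨s, hs⟩ := hy
    exact ⟨r + s, by simp [hr, hs]⟩
  | smul a x _ hx =>
    obtain ⟨r, hr⟩ := hx
    exact ⟨a * r, by simp [hr]⟩

theorem HasRealTraces.hasOnlyRealScalars (hd : 0 < d) {X : Fin m → Matrix (Fin d) (Fin d) ℂ}
    (h : HasRealTraces X) : HasOnlyRealScalars X := by
  apply Set.Subset.antisymm
  · rintro _ ⟨hA, z, rfl⟩
    obtain ⟨r, hr⟩ := trace_real_of_mem_realStarAlg h hA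
    have hd' : (d : ℂ) ≠ 0 := by exact_mod_cast hd.ne'
    simp only [trace_smul, trace_one, Fintype.card_fin, smul_eq_mul] at hr
    refine ⟨r / d, ?_⟩
    have : z = ((r / d : ℝ) : ℂ) := by
      push_cast
      rw [← hr]; field_simp
    simp only [this]
    ext i j; simp [Matrix.smul_apply]
  · rintro _ ⟨r, rfl⟩
    refine ⟨(realStarAlg X).toSubalgebra.smul_mem (one_mem _) r, r, ?_⟩
    ext i j; simp [Matrix.smul_apply]

theorem HasOnlyRealScalars.realStarAlg_ne_top (hd : 0 < d)
    {X : Fin m → Matrix (Fin d) (Fin d) ℂ} (h : HasOnlyRealScalars X) : realStarAlg X ≠ ⊤ := by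
  intro ht
  have : Complex.I • (1 : Matrix (Fin d) (Fin d) ℂ) ∈
      Set.range (fun r : ℝ => r • (1 : Matrix (Fin d) (Fin d) ℂ)) := by
    rw [← h, ht]
    exact ⟨StarSubalgebra.mem_top, _, rfl⟩
  obtain ⟨r, hr⟩ := this
  have := congrArg Complex.im (congrFun (congrFun hr ⟨0, hd⟩) ⟨0, hd⟩)
  simp at this

theorem I_smul_I_smul (A : Matrix (Fin d) (Fin d) ℂ) : Complex.I • Complex.I • A = -A := by
  rw [smul_smul]; simp

/-- An irreducible collection generates everything as the complexification of its real algebra. -/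
theorem exists_mem_realStarAlg_eq_add {X : Fin m → Matrix (Fin d) (Fin d) ℂ}
    (hX : IsIrreducibleCollection X) (M : Matrix (Fin d) (Fin d) ℂ) :
    ∃ a ∈ realStarAlg X, ∃ b ∈ realStarAlg X, M = a + Complex.I • b := by
  have hM : M ∈ complexStarAlg X := by rw [hX]; exact StarSubalgebra.mem_top
  induction hM using StarAlgebra.adjoin_induction with
  | mem x hx => exact ⟨x, StarAlgebra.subset_adjoin ℝ _ hx, 0, zero_mem _, by simp⟩
  | algebraMap z =>
    refine ⟨z.re • 1, (realStarAlg X).toSubalgebra.smul_mem (one_mem _) _,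
      z.im • 1, (realStarAlg X).toSubalgebra.smul_mem (one_mem _) _, ?_⟩
    rw [Algebra.algebraMap_eq_smul_one]
    ext i j
    by_cases hij : i = j
    · subst hij
      simp [Matrix.smul_apply, mul_comm Complex.I]
    · simp [Matrix.smul_apply, hij]
  | add x y _ _ hx hy =>
    obtain ⟨a, ha, b, hb, rfl⟩ := hx
    obtain ⟨a', ha', b', hb', rfl⟩ := hy
    exact ⟨_, add_mem ha ha', _, add_mem hb hb', by rw [smul_add]; abel⟩
  | mul x y _ _ hx hy =>
    obtain ⟨a, ha, b, hb, rfl⟩ := hx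
    obtain ⟨a', ha', b', hb', rfl⟩ := hy
    refine ⟨_, sub_mem (mul_mem ha ha') (mul_mem hb hb'), _,
      add_mem (mul_mem ha hb') (mul_mem hb ha'), ?_⟩
    simp only [add_mul, mul_add, smul_mul_assoc, mul_smul_comm, I_smul_I_smul, smul_add]
    abel
  | star x _ hx =>
    obtain ⟨a, ha, b, hb, rfl⟩ := hx
    exact ⟨_, star_mem ha, _, neg_mem (star_mem hb), by simp [star_smul]⟩

/-- The elements of the real algebra that stay in it after multiplication by `i` form an ideal of
the full matrix algebra. -/
noncomputable def complexPartIdeal {X : Fin m → Matrix (Fin d) (Fin d) ℂ}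
    (hX : IsIrreducibleCollection X) : TwoSidedIdeal (Matrix (Fin d) (Fin d) ℂ) :=
  TwoSidedIdeal.mk' {b | b ∈ realStarAlg X ∧ Complex.I • b ∈ realStarAlg X}
    ⟨zero_mem _, by simp [zero_mem]⟩
    (fun hx hy => ⟨add_mem hx.1 hy.1, by rw [smul_add]; exact add_mem hx.2 hy.2⟩)
    (fun hx => ⟨neg_mem hx.1, by rw [smul_neg]; exact neg_mem hx.2⟩)
    -- With `x = a + ib`, the product `x y` equals `a y + b (i y)`, so both summands stay in the
    -- real algebra.
    (fun {x y} hy => by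
      obtain ⟨a, ha, b, hb, rfl⟩ := exists_mem_realStarAlg_eq_add hX x
      constructor
      · rw [add_mul, smul_mul_assoc, ← mul_smul_comm]
        exact add_mem (mul_mem ha hy.1) (mul_mem hb hy.2)
      · rw [add_mul, smul_add, smul_mul_assoc, I_smul_I_smul, ← mul_smul_comm]
        exact add_mem (mul_mem ha hy.2) (neg_mem (mul_mem hb hy.1)))
    (fun {x y} hx => by
      obtain ⟨a, ha, b, hb, rfl⟩ := exists_mem_realStarAlg_eq_add hX y
      constructor
      · rw [mul_add, mul_smul_comm, ← smul_mul_assoc]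
        exact add_mem (mul_mem hx.1 ha) (mul_mem hx.2 hb)
      · rw [mul_add, smul_add, mul_smul_comm, I_smul_I_smul, ← smul_mul_assoc]
        exact add_mem (mul_mem hx.2 ha) (neg_mem (mul_mem hx.1 hb)))

/-- Simplicity of the matrix ring leaves two options for `complexPartIdeal`, and the full ring would
force the real algebra to be everything. This makes the sum `A + iA` direct. -/
theorem eq_zero_of_I_smul_mem [NeZero d] {X : Fin m → Matrix (Fin d) (Fin d) ℂ}
    (hX : IsIrreducibleCollection X) (h : realStarAlg X ≠ ⊤) {b : Matrix (Fin d) (Fin d) ℂ}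
    (hb : b ∈ realStarAlg X) (hb' : Complex.I • b ∈ realStarAlg X) : b = 0 := by
  have hmem : ∀ x, x ∈ complexPartIdeal hX ↔
      x ∈ realStarAlg X ∧ Complex.I • x ∈ realStarAlg X := fun x => by
    unfold complexPartIdeal
    rw [TwoSidedIdeal.mem_mk']; rfl
  rcases eq_bot_or_eq_top (complexPartIdeal hX) with h0 | h1
  · have := (hmem b).mpr ⟨hb, hb'⟩
    rwa [h0, TwoSidedIdeal.mem_bot] at this
  · refine absurd (eq_top_iff.mpr fun M _ => ?_) h
    exact ((hmem M).mp (by rw [h1]; trivial)).1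

/-- The complex linear extension of entrywise conjugation on the real algebra. -/
theorem exists_algHom_eq_entryConj [NeZero d] {X : Fin m → Matrix (Fin d) (Fin d) ℂ}
    (hX : IsIrreducibleCollection X) (h : realStarAlg X ≠ ⊤) :
    ∃ f : Matrix (Fin d) (Fin d) ℂ →ₐ[ℂ] Matrix (Fin d) (Fin d) ℂ,
      ∀ a ∈ realStarAlg X, f a = entryConj d a := by
  choose re hre im him hdec using exists_mem_realStarAlg_eq_add hX
  have huniq : ∀ a ∈ realStarAlg X, ∀ b ∈ realStarAlg X,
      re (a + Complex.I • b) = a ∧ im (a + Complex.I • b) = b := by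
    intro a ha b hb
    have h1 := hdec (a + Complex.I • b)
    set a' := re (a + Complex.I • b)
    set b' := im (a + Complex.I • b)
    have ha' : a' ∈ realStarAlg X := hre _
    have hb' : b' ∈ realStarAlg X := him _
    have h2 : Complex.I • (b - b') = a' - a := by
      rw [smul_sub, sub_eq_sub_iff_add_eq_add, add_comm, h1]
    have h3 := eq_zero_of_I_smul_mem hX h (sub_mem hb hb') (by rw [h2]; exact sub_mem ha' ha)
    rw [h3, smul_zero] at h2
    exact ⟨(sub_eq_zero.mp h2.symm), (sub_eq_zero.mp h3).symm⟩
  let f : Matrix (Fin d) (Fin d) ℂ → Matrix (Fin d) (Fin d) ℂ :=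
    fun M => entryConj d (re M) + Complex.I • entryConj d (im M)
  have hf : ∀ a ∈ realStarAlg X, ∀ b ∈ realStarAlg X,
      f (a + Complex.I • b) = entryConj d a + Complex.I • entryConj d b := by
    intro a ha b hb
    simp only [f, huniq a ha b hb]
  have hfr : ∀ a ∈ realStarAlg X, f a = entryConj d a := by
    intro a ha
    simpa using hf a ha 0 (zero_mem _)
  have hadd : ∀ x y, f (x + y) = f x + f y := by
    intro x y
    obtain ⟨a, ha, b, hb, rfl⟩ := exists_mem_realStarAlg_eq_add hX x
    obtain ⟨a', ha', b', hb', rfl⟩ := exists_mem_realStarAlg_eq_add hX y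
    rw [hf a ha b hb, hf a' ha' b' hb', add_add_add_comm, ← smul_add,
      hf _ (add_mem ha ha') _ (add_mem hb hb'), map_add, map_add, smul_add]
    abel
  have hmul : ∀ x y, f (x * y) = f x * f y := by
    intro x y
    obtain ⟨a, ha, b, hb, rfl⟩ := exists_mem_realStarAlg_eq_add hX x
    obtain ⟨a', ha', b', hb', rfl⟩ := exists_mem_realStarAlg_eq_add hX y
    have h1 : (a + Complex.I • b) * (a' + Complex.I • b') =
        (a * a' - b * b') + Complex.I • (a * b' + b * a') := by
      simp only [add_mul, mul_add, smul_mul_assoc, mul_smul_comm, I_smul_I_smul, smul_add]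
      abel
    rw [h1, hf _ (sub_mem (mul_mem ha ha') (mul_mem hb hb')) _
      (add_mem (mul_mem ha hb') (mul_mem hb ha')), hf a ha b hb, hf a' ha' b' hb']
    simp only [map_sub, map_add, map_mul, add_mul, mul_add, smul_mul_assoc, mul_smul_comm,
      I_smul_I_smul, smul_add]
    abel
  have hone : f 1 = 1 := by rw [hfr 1 (one_mem _), map_one]
  have hzero : f 0 = 0 := by rw [hfr 0 (zero_mem _), map_zero]
  refine ⟨{ toFun := f, map_one' := hone, map_mul' := hmul, map_zero' := hzero, map_add' := hadd,
            commutes' := fun z => ?_ }, hfr⟩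
  have h1 : algebraMap ℂ (Matrix (Fin d) (Fin d) ℂ) z = z.re • 1 + Complex.I • z.im • 1 := by
    rw [Algebra.algebraMap_eq_smul_one]
    ext i j
    by_cases hij : i = j
    · subst hij
      simp [Matrix.smul_apply, mul_comm Complex.I]
    · simp [Matrix.smul_apply, hij]
  change f _ = _
  rw [h1, hf _ ((realStarAlg X).toSubalgebra.smul_mem (one_mem _) _) _
    ((realStarAlg X).toSubalgebra.smul_mem (one_mem _) _), entryConj_real_smul,
    entryConj_real_smul, map_one]

/-- Algebra endomorphisms of a full matrix algebra over a field are inner. -/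
theorem exists_isUnit_forall_mul_eq {K n : Type*} [Field K] [Fintype n] [DecidableEq n]
    [Nonempty n] (f : Matrix n n K →ₐ[K] Matrix n n K) :
    ∃ T : Matrix n n K, IsUnit T ∧ ∀ M, T * M = f M * T := by
  have hinj : Function.Injective f := f.toRingHom.injective
  have hbij : Function.Bijective f :=
    ⟨hinj, (LinearMap.injective_iff_surjective (f := f.toLinearMap)).mp hinj⟩
  let g := AlgEquiv.ofBijective f hbij
  let e : Matrix n n K ≃ₐ[K] Module.End K (n → K) := Matrix.toLinAlgEquiv'
  obtain ⟨S, hS⟩ := ((e.symm.trans g).trans e).eq_linearEquivConjAlgEquiv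
  have hM : ∀ M, e (f M) = S.conjAlgEquiv K (e M) := fun M => by
    rw [← hS]; simp [g]
  refine ⟨e.symm S.toLinearMap, ?_, fun M => ?_⟩
  · refine IsUnit.map e.symm ?_
    exact ⟨⟨S.toLinearMap, S.symm.toLinearMap, by ext; simp, by ext; simp⟩, rfl⟩
  · apply e.injective
    rw [map_mul, map_mul, hM, AlgEquiv.apply_symm_apply]
    ext x : 1
    refine LinearMap.ext fun y => ?_
    simp [LinearEquiv.conjAlgEquiv_apply]

/-- Schur's lemma for an irreducible collection. -/
theorem IsIrreducibleCollection.exists_eq_smul_one {X : Fin m → Matrix (Fin d) (Fin d) ℂ}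
    (hX : IsIrreducibleCollection X) {M : Matrix (Fin d) (Fin d) ℂ}
    (h : ∀ j, X j * M = M * X j) (h' : ∀ j, (X j)ᴴ * M = M * (X j)ᴴ) :
    ∃ c : ℂ, M = c • 1 := by
  have key : ∀ A, A * M = M * A := by
    intro A
    have hA : A ∈ complexStarAlg X := by rw [hX]; exact StarSubalgebra.mem_top
    suffices H : A * M = M * A ∧ star A * M = M * star A from H.1
    induction hA using StarAlgebra.adjoin_induction with
    | mem x hx =>
      obtain ⟨j, rfl⟩ := hx
      exact ⟨h j, h' j⟩
    | algebraMap z => simp [Algebra.algebraMap_eq_smul_one]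
    | add x y _ _ hx hy => simp [add_mul, mul_add, hx, hy]
    | mul x y _ _ hx hy =>
      rw [star_mul]
      constructor
      · rw [Matrix.mul_assoc, hy.1, ← Matrix.mul_assoc, hx.1, Matrix.mul_assoc]
      · rw [Matrix.mul_assoc, hx.2, ← Matrix.mul_assoc, hy.2, Matrix.mul_assoc]
    | star x _ hx => exact ⟨hx.2, by rw [star_star]; exact hx.1⟩
  obtain ⟨c, hc⟩ := mem_range_scalar_of_commute_single (M := M) fun i j _ => key _
  exact ⟨c, by rw [← hc]; simp [Matrix.smul_one_eq_diagonal]⟩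

open scoped ComplexOrder in
theorem isUnitarilySelfConj_of_realStarAlg_ne_top (hd : 0 < d)
    {X : Fin m → Matrix (Fin d) (Fin d) ℂ} (hX : IsIrreducibleCollection X)
    (h : realStarAlg X ≠ ⊤) : IsUnitarilySelfConj X := by
  have : NeZero d := ⟨hd.ne'⟩
  obtain ⟨f, hf⟩ := exists_algHom_eq_entryConj hX h
  obtain ⟨T, hT, hTf⟩ := exists_isUnit_forall_mul_eq f
  have hT1 : ∀ a ∈ realStarAlg X, T * a = entryConj d a * T := fun a ha => by rw [hTf, hf a ha]
  -- Adjoint of `hT1` at `star a`; closure of the real algebra under `star` is what makes `Tᴴ * T`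
  -- central.
  have hT2 : ∀ a ∈ realStarAlg X, a * Tᴴ = Tᴴ * entryConj d a := fun a ha => by
    have := congrArg conjTranspose (hT1 _ (star_mem ha))
    rwa [conjTranspose_mul, conjTranspose_mul, star_eq_conjTranspose, entryConj_conjTranspose,
      conjTranspose_conjTranspose, conjTranspose_conjTranspose] at this
  have hcomm : ∀ a ∈ realStarAlg X, a * (Tᴴ * T) = Tᴴ * T * a := fun a ha => by
    rw [← Matrix.mul_assoc, hT2 a ha, Matrix.mul_assoc, ← hT1 a ha, Matrix.mul_assoc]
  have hXmem : ∀ j, X j ∈ realStarAlg X := fun j => StarAlgebra.subset_adjoin ℝ _ ⟨j, rfl⟩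
  obtain ⟨c, hc⟩ := hX.exists_eq_smul_one (M := Tᴴ * T) (fun j => hcomm _ (hXmem j))
    (fun j => hcomm _ (star_mem (hXmem j)))
  obtain ⟨r, hr0, hr⟩ : ∃ r : ℝ, 0 ≤ r ∧ c = r := by
    have h0 := congrFun (congrFun hc 0) 0
    simp only [Matrix.mul_apply, conjTranspose_apply, Matrix.smul_apply, one_apply_eq,
      smul_eq_mul, mul_one] at h0
    refine ⟨∑ k, ‖T k 0‖ ^ 2, by positivity, ?_⟩
    rw [← h0]
    push_cast
    exact Finset.sum_congr rfl fun k _ => by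
      rw [← Complex.conj_mul']; rfl
  have hrpos : 0 < r := by
    refine lt_of_le_of_ne hr0 fun h0 => ?_
    rw [hr, ← h0, Complex.ofReal_zero, zero_smul, conjTranspose_mul_self_eq_zero] at hc
    rw [hc] at hT
    exact not_isUnit_zero hT
  set s : ℂ := (((Real.sqrt r)⁻¹ : ℝ) : ℂ) with hs
  have hss : star s * s * r = 1 := by
    have : (Real.sqrt r)⁻¹ * (Real.sqrt r)⁻¹ * r = 1 := by
      rw [← mul_inv, Real.mul_self_sqrt hr0, inv_mul_cancel₀ hrpos.ne']
    rw [hs, Complex.star_def, Complex.conj_ofReal]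
    exact_mod_cast this
  have hU : (s • T)ᴴ * (s • T) = 1 := by
    rw [conjTranspose_smul, smul_mul_assoc, mul_smul_comm, hc, hr, smul_smul, smul_smul,
      hss, one_smul]
  have hU' : (s • T) * (s • T)ᴴ = 1 := mul_eq_one_comm.mp hU
  refine ⟨s • T, mem_unitaryGroup_iff.mpr hU', fun j => ?_⟩
  rw [map_starRingEnd_eq_entryConj, smul_mul_assoc, hT1 _ (hXmem j), ← mul_smul_comm,
    Matrix.mul_assoc, hU', Matrix.mul_one]

theorem tfae_isUnitarilySelfConj (hd : 0 < d) {X : Fin m → Matrix (Fin d) (Fin d) ℂ}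
    (hX : IsIrreducibleCollection X) :
    List.TFAE [IsUnitarilySelfConj X, HasRealTraces X, HasOnlyRealScalars X,
      realStarAlg X ≠ ⊤] := by
  tfae_have 1 → 2 := IsUnitarilySelfConj.hasRealTraces
  tfae_have 2 → 3 := HasRealTraces.hasOnlyRealScalars hd
  tfae_have 3 → 4 := HasOnlyRealScalars.realStarAlg_ne_top hd
  tfae_have 4 → 1 := isUnitarilySelfConj_of_realStarAlg_ne_top hd hX
  tfae_finish

end Conj

/-! ### Symmetric intertwining unitaries give a real form -/

section RealForm

variable {d m : ℕ}

theorem entryConj_mul_eq_of_isUnitary {U Y : Matrix (Fin d) (Fin d) ℂ}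
    (hU : U ∈ unitaryGroup (Fin d) ℂ) (h : U * Y * Uᴴ = entryConj d Y) :
    U * Y = entryConj d Y * U := by
  rw [← h, Matrix.mul_assoc (U * Y), conjTranspose_mul_self_of_mem_unitaryGroup hU, Matrix.mul_one]

theorem conj_conjTranspose_eq_entryConj {U Y : Matrix (Fin d) (Fin d) ℂ}
    (h : U * Y * Uᴴ = entryConj d Y) : U * Yᴴ * Uᴴ = entryConj d Yᴴ := by
  rw [entryConj_conjTranspose, ← h]
  simp [Matrix.mul_assoc]

/-- The unitary that implements entrywise conjugation on an irreducible collection is symmetric or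
antisymmetric. -/
theorem transpose_eq_or_eq_neg (hd : 0 < d) {X : Fin m → Matrix (Fin d) (Fin d) ℂ}
    (hX : IsIrreducibleCollection X) {U : Matrix (Fin d) (Fin d) ℂ}
    (hU : U ∈ unitaryGroup (Fin d) ℂ) (h : ∀ j, U * X j * Uᴴ = entryConj d (X j)) :
    Uᵀ = U ∨ Uᵀ = -U := by
  have : NeZero d := ⟨hd.ne'⟩
  have hcomm : ∀ Y, U * Y * Uᴴ = entryConj d Y →
      Y * (entryConj d U * U) = entryConj d U * U * Y := by
    intro Y hY
    have h1 := entryConj_mul_eq_of_isUnitary hU hY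
    have h2 := congrArg (entryConj d) h1
    rw [map_mul, map_mul, entryConj_entryConj] at h2
    rw [← Matrix.mul_assoc, ← h2, Matrix.mul_assoc, ← h1, Matrix.mul_assoc]
  obtain ⟨c, hc⟩ := hX.exists_eq_smul_one (fun j => hcomm _ (h j))
    (fun j => hcomm _ (conj_conjTranspose_eq_entryConj (h j)))
  have hUU := self_mul_conjTranspose_of_mem_unitaryGroup hU
  have h1 : entryConj d U = c • Uᴴ := by
    rw [← Matrix.mul_one (entryConj d U), ← hUU, ← Matrix.mul_assoc, hc, smul_mul_assoc, one_mul]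
  have h2 : Uᵀ = star c • U := by
    have : (entryConj d U)ᴴ = Uᵀ := by ext i j; simp [entryConj]
    rw [← this, h1, conjTranspose_smul, conjTranspose_conjTranspose]
  have h3 : (star c * star c) • U = U := by
    rw [← smul_smul, ← h2, ← transpose_smul, ← h2, transpose_transpose]
  have hU0 : U ≠ 0 := by
    rintro rfl
    simp at hUU
  have h4 : star c * star c = 1 := by
    by_contra hne
    have : (star c * star c - 1) • U = 0 := by rw [sub_smul, h3, one_smul, sub_self]
    rcases smul_eq_zero.mp this with h0 | h0
    · exact hne (sub_eq_zero.mp h0)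
    · exact hU0 h0
  rcases mul_self_eq_one_iff.mp h4 with h5 | h5
  · left; rw [h2, h5, one_smul]
  · right; rw [h2, h5, neg_one_smul]

/-- The circle is infinite, while `-U` has only finitely many eigenvalues to avoid. -/
theorem exists_norm_eq_one_isUnit_add (U : Matrix (Fin d) (Fin d) ℂ) :
    ∃ t : ℂ, star t * t = 1 ∧ IsUnit (t • 1 + U) := by
  have : Infinite (Set.Ioc (-Real.pi) Real.pi) :=
    (Set.Ioc_infinite (by linarith [Real.pi_pos])).to_subtype
  have : Infinite Circle := .of_injective _ Circle.argEquiv.symm.injective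
  have hinf : (Set.range fun x : Circle => (x : ℂ)).Infinite :=
    Set.infinite_range_of_injective Circle.coe_injective
  have hne : (-U).charpoly ≠ 0 := (charpoly_monic _).ne_zero
  obtain ⟨_, ⟨t, rfl⟩, ht⟩ := hinf.exists_notMem_finset (-U).charpoly.roots.toFinset
  refine ⟨t, ?_, ?_⟩
  · rw [Complex.star_def, ← Complex.normSq_eq_conj_mul_self, Circle.normSq_coe,
      Complex.ofReal_one]
  · rw [Multiset.mem_toFinset, Polynomial.mem_roots hne, Polynomial.IsRoot, eval_charpoly] at ht
    rw [isUnit_iff_isUnit_det, isUnit_iff_ne_zero]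
    convert ht using 3
    rw [sub_neg_eq_add, Matrix.smul_one_eq_diagonal]; rfl

-- The conjugate of the positive square root is again a positive square root of the same real
-- matrix, so uniqueness makes it real.
open scoped ComplexOrder MatrixOrder in
theorem exists_real_sqrt {T : Matrix (Fin d) (Fin d) ℂ} (hT : IsUnit T)
    (h : entryConj d (T * Tᴴ) = T * Tᴴ) :
    ∃ S : Matrix (Fin d) (Fin d) ℂ, Sᴴ = S ∧ entryConj d S = S ∧ S * S = T * Tᴴ ∧ IsUnit S := by
  have hH : (T * Tᴴ).PosSemidef := posSemidef_self_mul_conjTranspose T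
  have hS : (CFC.sqrt (T * Tᴴ)).PosSemidef := nonneg_iff_posSemidef.mp (CFC.sqrt_nonneg _)
  have hSS : CFC.sqrt (T * Tᴴ) * CFC.sqrt (T * Tᴴ) = T * Tᴴ :=
    CFC.sqrt_mul_sqrt_self _ hH.nonneg
  refine ⟨CFC.sqrt (T * Tᴴ), hS.isHermitian, ?_, hSS, ?_⟩
  · have h1 : (entryConj d (CFC.sqrt (T * Tᴴ))).PosSemidef := by
      rw [entryConj_eq_transpose_conjTranspose, hS.isHermitian.eq]
      exact hS.transpose
    refine ((CFC.sqrt_eq_iff _ _ hH.nonneg h1.nonneg).mpr ?_).symm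
    rw [← map_mul, hSS, h]
  · refine isUnit_of_mul_isUnit_left (y := CFC.sqrt (T * Tᴴ)) ?_
    rw [hSS]
    exact hT.mul hT.star

/-- Symmetry means `Ū = Uᴴ`, so `T = t + U` satisfies `T̄ = t̄ T Uᴴ`. Hence `T Y Tᴴ` is real for
every `Y` with `U Y Uᴴ = Ȳ`. The matrix `T` need not be unitary, but `T Tᴴ` is real (take `Y = 1`),
and dividing by its real square root keeps reality while yielding the unitary polar factor. -/
theorem isUnitarilyReal_of_transpose_eq_self {X : Fin m → Matrix (Fin d) (Fin d) ℂ}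
    {U : Matrix (Fin d) (Fin d) ℂ} (hU : U ∈ unitaryGroup (Fin d) ℂ)
    (h : ∀ j, U * X j * Uᴴ = entryConj d (X j)) (hUT : Uᵀ = U) : IsUnitarilyReal X := by
  obtain ⟨t, ht, hunit⟩ := exists_norm_eq_one_isUnit_add U
  set T := t • 1 + U with hTdef
  have hUU := self_mul_conjTranspose_of_mem_unitaryGroup hU
  have hUU' := conjTranspose_mul_self_of_mem_unitaryGroup hU
  have hcU : entryConj d U = Uᴴ := by
    nth_rw 2 [← hUT]
    ext i j; simp [entryConj]
  have hcT : entryConj d T = star t • (T * Uᴴ) := by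
    rw [hTdef, map_add, entryConj_smul, map_one, hcU, add_mul, hUU, smul_mul_assoc, one_mul,
      smul_add, smul_smul, ht, one_smul, add_comm]
  have hcT' : (entryConj d T)ᴴ = t • (U * Tᴴ) := by
    rw [hcT, conjTranspose_smul, conjTranspose_mul, conjTranspose_conjTranspose, star_star]
  have hreal : ∀ Y, U * Y * Uᴴ = entryConj d Y → entryConj d (T * Y * Tᴴ) = T * Y * Tᴴ := by
    intro Y hY
    rw [map_mul, map_mul, entryConj_conjTranspose, hcT', hcT, ← hY, smul_mul_assoc,
      smul_mul_assoc, mul_smul_comm, smul_smul, ht, one_smul]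
    calc T * Uᴴ * (U * Y * Uᴴ) * (U * Tᴴ) = T * (Uᴴ * U) * Y * (Uᴴ * U) * Tᴴ := by
          simp only [Matrix.mul_assoc]
      _ = T * Y * Tᴴ := by rw [hUU']; simp
  have h1 := hreal 1 (by rw [Matrix.mul_one, hUU, map_one])
  rw [Matrix.mul_one] at h1
  obtain ⟨S, hS, hSr, hSS, hSu⟩ := exists_real_sqrt hunit h1
  have hdet : IsUnit S.det := (isUnit_iff_isUnit_det _).mp hSu
  have hSinv : entryConj d S⁻¹ = S⁻¹ := by
    refine (inv_eq_left_inv ?_).symm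
    nth_rw 2 [← hSr]
    rw [← map_mul, nonsing_inv_mul _ hdet, map_one]
  have hSinvH : (S⁻¹)ᴴ = S⁻¹ := by rw [conjTranspose_nonsing_inv, hS]
  refine ⟨S⁻¹ * T, ?_, fun j => ?_⟩
  · rw [mem_unitaryGroup_iff, star_eq_conjTranspose, conjTranspose_mul, hSinvH]
    calc S⁻¹ * T * (Tᴴ * S⁻¹) = S⁻¹ * (S * S) * S⁻¹ := by rw [hSS]; simp only [Matrix.mul_assoc]
      _ = (S⁻¹ * S) * (S * S⁻¹) := by simp only [Matrix.mul_assoc]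
      _ = 1 := by rw [nonsing_inv_mul _ hdet, mul_nonsing_inv _ hdet, one_mul]
  · rw [← entryConj_eq_self_iff]
    have : S⁻¹ * T * X j * (S⁻¹ * T)ᴴ = S⁻¹ * (T * X j * Tᴴ) * S⁻¹ := by
      rw [conjTranspose_mul, hSinvH]; simp only [Matrix.mul_assoc]
    rw [this, map_mul, map_mul, hSinv, hreal _ (h j)]

end RealForm

/-! ### Excluding antisymmetric intertwiners: odd dimension and dimension two -/

section Symplectic

variable {d m : ℕ}

/-- Used both for `U` itself and for Gram matrices on ranges of projections. -/
theorem not_odd_of_transpose_eq_neg {n : Type*} [Fintype n] [DecidableEq n]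
    {U : Matrix n n ℂ} (hU : U.det ≠ 0) (h : Uᵀ = -U) : ¬ Odd (Fintype.card n) := by
  intro hodd
  have h1 : U.det = -U.det := by
    conv_lhs => rw [← det_transpose, h, det_neg, hodd.neg_one_pow, neg_one_mul]
  exact hU (self_eq_neg.mp h1)

/-- An antisymmetric 2×2 matrix is a multiple of the standard symplectic one, for which only scalars
are self-adjoint. Scalar generators commute with a matrix unit, against Schur's lemma. -/
theorem not_isHermitian_of_transpose_eq_neg {X : Fin m → Matrix (Fin 2) (Fin 2) ℂ}
    (hX : IsIrreducibleCollection X) {U : Matrix (Fin 2) (Fin 2) ℂ} (hU : U.det ≠ 0)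
    (hUT : Uᵀ = -U) (h : ∀ j, U * X j = (X j)ᵀ * U) : ¬ ∀ j, (X j).IsHermitian := by
  intro hherm
  have e (i j) : U j i = -U i j := congrFun (congrFun hUT i) j
  have e0 : U 0 0 = 0 := self_eq_neg.mp (e 0 0)
  have e1 : U 1 1 = 0 := self_eq_neg.mp (e 1 1)
  have e2 : U 1 0 = -U 0 1 := e 0 1
  have hu : U 0 1 ≠ 0 := by
    intro h0
    exact hU (by rw [det_fin_two, e0, e2, h0]; simp)
  have hscalar : ∀ j, X j = X j 0 0 • 1 := by
    intro j
    have f (a b) := congrFun (congrFun (h j) a) b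
    have f00 := f 0 0
    have f01 := f 0 1
    have f11 := f 1 1
    simp only [Matrix.mul_apply, Fin.sum_univ_two, e0, e1, e2, transpose_apply] at f00 f01 f11
    have g00 : X j 1 0 = 0 := by
      have : U 0 1 * (2 * X j 1 0) = 0 := by linear_combination f00
      simpa [hu] using this
    have g11 : X j 0 1 = 0 := by
      have : U 0 1 * (2 * X j 0 1) = 0 := by linear_combination -f11
      simpa [hu] using this
    have g01 : X j 1 1 = X j 0 0 := by
      apply mul_left_cancel₀ hu
      linear_combination f01
    ext a b
    fin_cases a <;> fin_cases b <;> simp [g00, g11, g01]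
  have hcomm (j) : X j * single 0 0 1 = single 0 0 1 * X j := by
    rw [hscalar j]; simp
  obtain ⟨c, hc⟩ := hX.exists_eq_smul_one (M := single 0 0 1) hcomm
    fun j => by rw [hherm j]; exact hcomm j
  have h0 := congrFun (congrFun hc 0) 0
  have h1 := congrFun (congrFun hc 1) 1
  simp at h0 h1
  rw [← h1] at h0
  exact one_ne_zero h0

/-! ### The symplectic form and ranks of self-adjoint idempotents -/

/-- The bilinear form with Gram matrix `Uᵀ`. -/
def matrixForm (U : Matrix (Fin d) (Fin d) ℂ) (v w : Fin d → ℂ) : ℂ := (U *ᵥ v) ⬝ᵥ w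

theorem matrixForm_add_right (U : Matrix (Fin d) (Fin d) ℂ) (v w w' : Fin d → ℂ) :
    matrixForm U v (w + w') = matrixForm U v w + matrixForm U v w' := dotProduct_add _ _ _

theorem matrixForm_smul_right (U : Matrix (Fin d) (Fin d) ℂ) (c : ℂ) (v w : Fin d → ℂ) :
    matrixForm U v (c • w) = c * matrixForm U v w := dotProduct_smul _ _ _

theorem matrixForm_swap {U : Matrix (Fin d) (Fin d) ℂ} (hU : Uᵀ = -U) (v w : Fin d → ℂ) :
    matrixForm U v w = -matrixForm U w v := by
  unfold matrixForm
  rw [dotProduct_comm, dotProduct_mulVec, ← mulVec_transpose, hU, neg_mulVec, neg_dotProduct]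

theorem matrixForm_self {U : Matrix (Fin d) (Fin d) ℂ} (hU : Uᵀ = -U) (v : Fin d → ℂ) :
    matrixForm U v v = 0 := self_eq_neg.mp (matrixForm_swap hU v v)

theorem matrixForm_mulVec_left {U P : Matrix (Fin d) (Fin d) ℂ} (h : U * P = Pᵀ * U)
    (v w : Fin d → ℂ) : matrixForm U (P *ᵥ v) w = matrixForm U v (P *ᵥ w) := by
  unfold matrixForm
  rw [mulVec_mulVec, h, ← mulVec_mulVec, mulVec_transpose, ← dotProduct_mulVec]

/-- Moving `P` across the form and then swapping the arguments changes the sign. -/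
theorem matrixForm_mulVec_self {U P : Matrix (Fin d) (Fin d) ℂ} (hU : Uᵀ = -U)
    (h : U * P = Pᵀ * U) (v : Fin d → ℂ) : matrixForm U v (P *ᵥ v) = 0 := by
  rw [← self_eq_neg]
  conv_lhs => rw [← matrixForm_mulVec_left h, matrixForm_swap hU]

theorem eq_zero_of_matrixForm_eq_zero {U : Matrix (Fin d) (Fin d) ℂ} (hU : IsUnit U)
    {v : Fin d → ℂ} (h : ∀ w, matrixForm U v w = 0) : v = 0 := by
  have h1 : U *ᵥ v = 0 := dotProduct_eq_zero _ h
  apply mulVec_injective_of_isUnit hU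
  rw [h1, mulVec_zero]

/-- An idempotent that is self-adjoint for the symplectic form has even rank. -/
theorem not_odd_rank {U P : Matrix (Fin d) (Fin d) ℂ} (hU : IsUnit U) (hUT : Uᵀ = -U)
    (hP : P * P = P) (h : U * P = Pᵀ * U) : ¬ Odd P.rank := by
  let V := LinearMap.range P.mulVecLin
  let b : Module.Basis (Fin P.rank) ℂ V := Module.finBasisOfFinrankEq ℂ V rfl
  have hPV : ∀ x ∈ V, P *ᵥ x = x := by
    rintro _ ⟨x, rfl⟩
    simp [mulVec_mulVec, hP]
  let G : Matrix (Fin P.rank) (Fin P.rank) ℂ := of fun i j => matrixForm U (b i) (b j)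
  have hG : Gᵀ = -G := by
    ext i j
    exact matrixForm_swap hUT _ _
  -- The form is nondegenerate on the range: if `x = P x` is orthogonal to the range, then `ω(x, w)
  -- = ω(x, P w) = 0` for every `w`.
  have hdet : G.det ≠ 0 := by
    intro h0
    obtain ⟨c, hc0, hc⟩ := exists_mulVec_eq_zero_iff.mpr h0
    let x : V := ∑ i, c i • b i
    have hbx : ∀ i, matrixForm U x (b i) = 0 := by
      intro i
      have h1 := congrFun hc i
      rw [matrixForm_swap hUT, neg_eq_zero]
      simp only [x, AddSubmonoidClass.coe_finsetSum, SetLike.val_smul]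
      unfold matrixForm
      rw [dotProduct_sum, ← Pi.zero_apply (M := fun _ : Fin P.rank => ℂ) i, ← h1]
      exact Finset.sum_congr rfl fun j _ => by
        rw [dotProduct_smul, smul_eq_mul, mul_comm]; rfl
    have hx : (x : Fin d → ℂ) = 0 := by
      refine eq_zero_of_matrixForm_eq_zero hU fun w => ?_
      have hw : P *ᵥ w ∈ V := ⟨w, rfl⟩
      rw [← hPV x x.2, matrixForm_mulVec_left h]
      have h2 : P *ᵥ w = ∑ i, b.repr ⟨P *ᵥ w, hw⟩ i • (b i : Fin d → ℂ) := by
        have := congrArg Subtype.val (b.sum_repr ⟨P *ᵥ w, hw⟩)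
        rw [AddSubmonoidClass.coe_finsetSum] at this
        exact this.symm
      rw [h2]
      unfold matrixForm at hbx ⊢
      rw [dotProduct_sum]
      exact Finset.sum_eq_zero fun i _ => by rw [dotProduct_smul, hbx, smul_zero]
    have hx' : ∑ i, c i • b i = 0 := Subtype.ext hx
    exact hc0 (funext (Fintype.linearIndependent_iff.mp b.linearIndependent c hx'))
  have := not_odd_of_transpose_eq_neg hdet hG
  rwa [Fintype.card_fin] at this

/-- Idempotents of rank at most two that are self-adjoint for the form of `U`. -/
structure IsPlaneProj (U P : Matrix (Fin d) (Fin d) ℂ) : Prop where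
  idem : P * P = P
  adj : U * P = Pᵀ * U
  rank_le : P.rank ≤ 2

theorem IsPlaneProj.mulVec_mulVec_self {U P : Matrix (Fin d) (Fin d) ℂ} (hP : IsPlaneProj U P)
    (x : Fin d → ℂ) : P *ᵥ P *ᵥ x = P *ᵥ x := by
  rw [mulVec_mulVec, hP.idem]

theorem rank_add_rank_one_sub_le {P : Matrix (Fin d) (Fin d) ℂ} (hP : P * P = P) :
    P.rank + (1 - P).rank ≤ d := by
  have h1 := LinearMap.finrank_range_add_finrank_ker P.mulVecLin
  have h2 : LinearMap.range (1 - P).mulVecLin ≤ LinearMap.ker P.mulVecLin := by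
    rintro _ ⟨x, rfl⟩
    rw [mulVecLin_apply, LinearMap.mem_ker, mulVecLin_apply, mulVec_mulVec, mul_sub, hP,
      Matrix.mul_one, sub_self, zero_mulVec]
  have h3 := Submodule.finrank_mono h2
  rw [Module.finrank_fin_fun] at h1
  unfold Matrix.rank
  omega

/-- An even rank above two is at least four, which leaves at most two for the complement in
dimension at most six. -/
theorem isPlaneProj_or_one_sub {U P : Matrix (Fin d) (Fin d) ℂ} (hU : IsUnit U)
    (hUT : Uᵀ = -U) (hd : d ≤ 6) (hP : P * P = P) (h : U * P = Pᵀ * U) :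
    IsPlaneProj U P ∨ IsPlaneProj U (1 - P) := by
  have hP' : (1 - P) * (1 - P) = 1 - P := by
    rw [mul_sub, Matrix.mul_one, sub_mul, hP, Matrix.one_mul, sub_self, sub_zero]
  have h' : U * (1 - P) = (1 - P)ᵀ * U := by
    rw [transpose_sub, transpose_one, mul_sub, sub_mul, h]; simp
  by_cases h2 : P.rank ≤ 2
  · exact .inl ⟨hP, h, h2⟩
  · refine .inr ⟨hP', h', ?_⟩
    have h3 := not_odd_rank hU hUT hP h
    have h4 : P.rank ≠ 3 := by rintro h5; rw [h5] at h3; exact h3 (by decide)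
    have h5 := rank_add_rank_one_sub_le hP
    omega

/-- In a symplectic plane a line is its own orthogonal complement. Otherwise `x` and `P y` would
span the range, and `x` would be orthogonal to everything. -/
theorem IsPlaneProj.exists_smul_eq {U P : Matrix (Fin d) (Fin d) ℂ} (hP : IsPlaneProj U P)
    (hU : IsUnit U) (hUT : Uᵀ = -U) {x y : Fin d → ℂ} (hx : x ≠ 0) (hPx : P *ᵥ x = x)
    (h : matrixForm U x y = 0) : ∃ c : ℂ, c • x = P *ᵥ y := by
  by_contra! hne
  have hli : LinearIndependent ℂ ![x, P *ᵥ y] := (LinearIndependent.pair_iff' hx).mpr hne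
  have hle : Submodule.span ℂ (Set.range ![x, P *ᵥ y]) ≤ LinearMap.range P.mulVecLin := by
    rw [Submodule.span_le]
    rintro _ ⟨i, rfl⟩
    fin_cases i
    · exact ⟨x, hPx⟩
    · exact ⟨y, rfl⟩
  have heq := Submodule.eq_of_le_of_finrank_le hle (by
    rw [finrank_span_eq_card hli]; exact hP.rank_le)
  refine hx (eq_zero_of_matrixForm_eq_zero hU fun w => ?_)
  have hw : P *ᵥ w ∈ Submodule.span ℂ (Set.range ![x, P *ᵥ y]) := by
    rw [heq]; exact ⟨w, rfl⟩
  rw [Matrix.range_cons, Matrix.range_cons, Matrix.range_empty, Set.union_empty,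
    Set.singleton_union, Submodule.mem_span_pair] at hw
  obtain ⟨a, b, hab⟩ := hw
  rw [← hPx, matrixForm_mulVec_left hP.adj, ← hab, matrixForm_add_right, matrixForm_smul_right,
    matrixForm_smul_right, matrixForm_self hUT, ← matrixForm_mulVec_left hP.adj, hPx, h]
  simp

theorem IsPlaneProj.exists_smul_mulVec_eq {U P : Matrix (Fin d) (Fin d) ℂ}
    (hP : IsPlaneProj U P) (hU : IsUnit U) (hUT : Uᵀ = -U) {x y : Fin d → ℂ}
    (hx : P *ᵥ x ≠ 0) (h : matrixForm U x (P *ᵥ y) = 0) : ∃ c : ℂ, c • P *ᵥ x = P *ᵥ y := by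
  refine hP.exists_smul_eq hU hUT hx ?_ ?_
  · rw [hP.mulVec_mulVec_self]
  · rw [matrixForm_mulVec_left hP.adj, h]

/-! ### A common invariant subspace of three plane projections -/

/-- A nonzero subspace of dimension at most three that is invariant under three matrices. -/
def HasSmallInvariantSubspace (P Q R : Matrix (Fin d) (Fin d) ℂ) : Prop :=
  ∃ W : Submodule ℂ (Fin d → ℂ), W ≠ ⊥ ∧ Module.finrank ℂ W ≤ 3 ∧
    ∀ w ∈ W, P *ᵥ w ∈ W ∧ Q *ᵥ w ∈ W ∧ R *ᵥ w ∈ W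

theorem HasSmallInvariantSubspace.swap_right {P Q R : Matrix (Fin d) (Fin d) ℂ}
    (h : HasSmallInvariantSubspace P Q R) : HasSmallInvariantSubspace P R Q := by
  obtain ⟨W, h0, h3, h⟩ := h
  exact ⟨W, h0, h3, fun w hw => ⟨(h w hw).1, (h w hw).2.2, (h w hw).2.1⟩⟩

theorem HasSmallInvariantSubspace.swap_left {P Q R : Matrix (Fin d) (Fin d) ℂ}
    (h : HasSmallInvariantSubspace P Q R) : HasSmallInvariantSubspace Q P R := by
  obtain ⟨W, h0, h3, h⟩ := h
  exact ⟨W, h0, h3, fun w hw => ⟨(h w hw).2.1, (h w hw).1, (h w hw).2.2⟩⟩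

theorem mulVec_mem_span_triple {S : Matrix (Fin d) (Fin d) ℂ} {u v w : Fin d → ℂ}
    (hu : S *ᵥ u ∈ Submodule.span ℂ {u, v, w}) (hv : S *ᵥ v ∈ Submodule.span ℂ {u, v, w})
    (hw : S *ᵥ w ∈ Submodule.span ℂ {u, v, w}) :
    ∀ x ∈ Submodule.span ℂ {u, v, w}, S *ᵥ x ∈ Submodule.span ℂ {u, v, w} := by
  have : Submodule.span ℂ {u, v, w} ≤ (Submodule.span ℂ {u, v, w}).comap S.mulVecLin := by
    rw [Submodule.span_le]
    rintro _ (rfl | rfl | rfl)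
    exacts [hu, hv, hw]
  exact fun x hx => this hx

theorem hasSmallInvariantSubspace_of_span {P Q R : Matrix (Fin d) (Fin d) ℂ}
    {u v w : Fin d → ℂ} (hu : u ≠ 0)
    (h : ∀ S ∈ ({P, Q, R} : Set (Matrix (Fin d) (Fin d) ℂ)),
      S *ᵥ u ∈ Submodule.span ℂ {u, v, w} ∧ S *ᵥ v ∈ Submodule.span ℂ {u, v, w} ∧
        S *ᵥ w ∈ Submodule.span ℂ {u, v, w}) : HasSmallInvariantSubspace P Q R := by
  have key : ∀ S ∈ ({P, Q, R} : Set (Matrix (Fin d) (Fin d) ℂ)),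
      ∀ x ∈ Submodule.span ℂ {u, v, w}, S *ᵥ x ∈ Submodule.span ℂ {u, v, w} :=
    fun S hS => mulVec_mem_span_triple (h S hS).1 (h S hS).2.1 (h S hS).2.2
  refine ⟨Submodule.span ℂ {u, v, w}, ?_, ?_, fun x hx => ⟨key P (by simp) x hx,
    key Q (by simp) x hx, key R (by simp) x hx⟩⟩
  · intro h0
    have : u ∈ Submodule.span ℂ {u, v, w} := Submodule.subset_span (by simp)
    rw [h0] at this
    exact hu this
  · have := finrank_span_finset_le_card (R := ℂ) ({u, v, w} : Finset (Fin d → ℂ))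
    rw [Finset.coe_insert, Finset.coe_insert, Finset.coe_singleton] at this
    exact this.trans Finset.card_le_three

/-- Self-adjointness gives `ω(v, Qv) = ω(v, Rv) = 0`, so `PQv` and `PRv` lie on the line of `v`. The
hypothesis says that `Qv` is orthogonal to `QRv` and, after a swap, `Rv` to `RQv`. If `Qv` and `Rv`
are nonzero, the span of `v`, `Qv`, `Rv` is therefore invariant. -/
theorem hasSmallInvariantSubspace_of_matrixForm_eq_zero {U P Q R : Matrix (Fin d) (Fin d) ℂ}
    (hU : IsUnit U) (hUT : Uᵀ = -U) (hP : IsPlaneProj U P) (hQ : IsPlaneProj U Q)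
    (hR : IsPlaneProj U R) {v : Fin d → ℂ} (hv : v ≠ 0) (hPv : P *ᵥ v = v)
    (h : matrixForm U v (Q *ᵥ R *ᵥ v) = 0) : HasSmallInvariantSubspace P Q R := by
  have h' : matrixForm U v (R *ᵥ Q *ᵥ v) = 0 := by
    rw [← matrixForm_mulVec_left hR.adj, ← matrixForm_mulVec_left hQ.adj, matrixForm_swap hUT, h,
      neg_zero]
  -- The case where one of the two other projections kills `v`.
  have aux : ∀ Q R : Matrix (Fin d) (Fin d) ℂ, IsPlaneProj U Q → IsPlaneProj U R →
      matrixForm U v (Q *ᵥ R *ᵥ v) = 0 → Q *ᵥ v = 0 → HasSmallInvariantSubspace P Q R := by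
    intro Q R hQ hR h hQv
    obtain ⟨a, ha⟩ := hP.exists_smul_eq hU hUT hv hPv (matrixForm_mulVec_self hUT hR.adj v)
    obtain ⟨b, hb⟩ := hP.exists_smul_eq hU hUT hv hPv h
    obtain ⟨c, hc⟩ : ∃ c : ℂ, c • R *ᵥ v = R *ᵥ Q *ᵥ R *ᵥ v := by
      by_cases hRv : R *ᵥ v = 0
      · exact ⟨0, by simp [hRv]⟩
      · refine hR.exists_smul_mulVec_eq hU hUT hRv ?_
        rw [← matrixForm_mulVec_left hR.adj, matrixForm_mulVec_self hUT hQ.adj]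
    have m1 : v ∈ Submodule.span ℂ {v, R *ᵥ v, Q *ᵥ R *ᵥ v} := Submodule.subset_span (by simp)
    have m2 : R *ᵥ v ∈ Submodule.span ℂ {v, R *ᵥ v, Q *ᵥ R *ᵥ v} :=
      Submodule.subset_span (by simp)
    have m3 : Q *ᵥ R *ᵥ v ∈ Submodule.span ℂ {v, R *ᵥ v, Q *ᵥ R *ᵥ v} :=
      Submodule.subset_span (by simp)
    -- Since `Qv = 0` no longer controls `QRv`, that vector takes the free third place in the span.
    refine hasSmallInvariantSubspace_of_span (u := v) (v := R *ᵥ v) (w := Q *ᵥ R *ᵥ v) hv ?_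
    rintro S (rfl | rfl | rfl)
    · exact ⟨by rwa [hPv], by rw [← ha]; exact Submodule.smul_mem _ _ m1,
        by rw [← hb]; exact Submodule.smul_mem _ _ m1⟩
    · exact ⟨by rw [hQv]; exact zero_mem _, m3, by rwa [hQ.mulVec_mulVec_self]⟩
    · exact ⟨m2, by rwa [hR.mulVec_mulVec_self], by rw [← hc]; exact Submodule.smul_mem _ _ m2⟩
  by_cases hQv : Q *ᵥ v = 0
  · exact aux Q R hQ hR h hQv
  by_cases hRv : R *ᵥ v = 0
  · exact (aux R Q hR hQ h' hRv).swap_right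
  obtain ⟨a, ha⟩ := hP.exists_smul_eq hU hUT hv hPv (matrixForm_mulVec_self hUT hQ.adj v)
  obtain ⟨b, hb⟩ := hP.exists_smul_eq hU hUT hv hPv (matrixForm_mulVec_self hUT hR.adj v)
  obtain ⟨c, hc⟩ := hQ.exists_smul_mulVec_eq hU hUT hQv h
  obtain ⟨e, he⟩ := hR.exists_smul_mulVec_eq hU hUT hRv h'
  have m1 : v ∈ Submodule.span ℂ {v, Q *ᵥ v, R *ᵥ v} := Submodule.subset_span (by simp)
  have m2 : Q *ᵥ v ∈ Submodule.span ℂ {v, Q *ᵥ v, R *ᵥ v} := Submodule.subset_span (by simp)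
  have m3 : R *ᵥ v ∈ Submodule.span ℂ {v, Q *ᵥ v, R *ᵥ v} := Submodule.subset_span (by simp)
  refine hasSmallInvariantSubspace_of_span (u := v) (v := Q *ᵥ v) (w := R *ᵥ v) hv ?_
  rintro S (rfl | rfl | rfl)
  · exact ⟨by rwa [hPv], by rw [← ha]; exact Submodule.smul_mem _ _ m1,
      by rw [← hb]; exact Submodule.smul_mem _ _ m1⟩
  · exact ⟨m2, by rwa [hQ.mulVec_mulVec_self], by rw [← hc]; exact Submodule.smul_mem _ _ m2⟩
  · exact ⟨m3, by rw [← he]; exact Submodule.smul_mem _ _ m3, by rwa [hR.mulVec_mulVec_self]⟩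

theorem exists_eigenvector_of_idempotent {P : Matrix (Fin d) (Fin d) ℂ} (hP : P * P = P)
    (hP0 : P ≠ 0) (S : Matrix (Fin d) (Fin d) ℂ) :
    ∃ v ≠ 0, P *ᵥ v = v ∧ ∃ c : ℂ, P *ᵥ S *ᵥ v = c • v := by
  let V := LinearMap.range P.mulVecLin
  have hPV : ∀ x ∈ V, P *ᵥ x = x := by
    rintro _ ⟨x, rfl⟩
    simp [mulVec_mulVec, hP]
  have : Nontrivial V := by
    rw [Submodule.nontrivial_iff_ne_bot]
    intro h
    apply hP0
    rw [LinearMap.range_eq_bot] at h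
    apply mulVec_injective
    ext x : 1
    simpa using LinearMap.congr_fun h x
  let f : Module.End ℂ V :=
    ((P.mulVecLin ∘ₗ S.mulVecLin ∘ₗ V.subtype).codRestrict V fun x => ⟨S *ᵥ x, rfl⟩)
  obtain ⟨c, hc⟩ := Module.End.exists_eigenvalue f
  obtain ⟨v, hv⟩ := hc.exists_hasEigenvector
  refine ⟨v, fun h => hv.2 (Subtype.ext h), hPV v v.2, c, ?_⟩
  exact congrArg Subtype.val hv.apply_eq_smul

/-- An eigenvector `v` of the compression of `QR` to the range of `P` satisfies `ω(v, QRv) = ω(v,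
PQRv) = c ω(v, v) = 0`. -/
theorem hasSmallInvariantSubspace_of_ne_zero {U P Q R : Matrix (Fin d) (Fin d) ℂ}
    (hU : IsUnit U) (hUT : Uᵀ = -U) (hP : IsPlaneProj U P) (hQ : IsPlaneProj U Q)
    (hR : IsPlaneProj U R) (hP0 : P ≠ 0) : HasSmallInvariantSubspace P Q R := by
  obtain ⟨v, hv, hPv, c, hc⟩ := exists_eigenvector_of_idempotent hP.idem hP0 (Q * R)
  refine hasSmallInvariantSubspace_of_matrixForm_eq_zero hU hUT hP hQ hR hv hPv ?_
  rw [← hPv, matrixForm_mulVec_left hP.adj, hPv, mulVec_mulVec v Q R, hc, matrixForm_smul_right,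
    matrixForm_self hUT, mul_zero]

theorem hasSmallInvariantSubspace (hd : 0 < d) {U P Q R : Matrix (Fin d) (Fin d) ℂ}
    (hU : IsUnit U) (hUT : Uᵀ = -U) (hP : IsPlaneProj U P) (hQ : IsPlaneProj U Q)
    (hR : IsPlaneProj U R) : HasSmallInvariantSubspace P Q R := by
  by_cases hP0 : P = 0
  · by_cases hQ0 : Q = 0
    · by_cases hR0 : R = 0
      · have : NeZero d := ⟨hd.ne'⟩
        refine hasSmallInvariantSubspace_of_span (u := 1) (v := 1) (w := 1) one_ne_zero ?_
        rintro S (rfl | rfl | rfl) <;> simp [hP0, hQ0, hR0]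
      · exact (hasSmallInvariantSubspace_of_ne_zero hU hUT hR hP hQ hR0).swap_left.swap_right
    · exact (hasSmallInvariantSubspace_of_ne_zero hU hUT hQ hP hR hQ0).swap_left
  · exact hasSmallInvariantSubspace_of_ne_zero hU hUT hP hQ hR hP0

theorem IsIrreducibleCollection.eq_top_of_invariant {X : Fin m → Matrix (Fin d) (Fin d) ℂ}
    (hX : IsIrreducibleCollection X) {W : Submodule ℂ (Fin d → ℂ)} (hW : W ≠ ⊥)
    (h : ∀ j, ∀ w ∈ W, X j *ᵥ w ∈ W) (h' : ∀ j, ∀ w ∈ W, (X j)ᴴ *ᵥ w ∈ W) : W = ⊤ := by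
  have key : ∀ A : Matrix (Fin d) (Fin d) ℂ, ∀ w ∈ W, A *ᵥ w ∈ W := by
    intro A
    have hA : A ∈ complexStarAlg X := by rw [hX]; exact StarSubalgebra.mem_top
    suffices H : (∀ w ∈ W, A *ᵥ w ∈ W) ∧ ∀ w ∈ W, star A *ᵥ w ∈ W from H.1
    induction hA using StarAlgebra.adjoin_induction with
    | mem x hx =>
      obtain ⟨j, rfl⟩ := hx
      exact ⟨h j, h' j⟩
    | algebraMap z =>
      simp only [Algebra.algebraMap_eq_smul_one, star_smul, star_one, smul_mulVec, one_mulVec]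
      exact ⟨fun w hw => W.smul_mem _ hw, fun w hw => W.smul_mem _ hw⟩
    | add x y _ _ hx hy =>
      simp only [star_add, add_mulVec]
      exact ⟨fun w hw => W.add_mem (hx.1 w hw) (hy.1 w hw),
        fun w hw => W.add_mem (hx.2 w hw) (hy.2 w hw)⟩
    | mul x y _ _ hx hy =>
      simp only [star_mul, ← mulVec_mulVec]
      exact ⟨fun w hw => hx.1 _ (hy.1 w hw), fun w hw => hy.2 _ (hx.2 w hw)⟩
    | star x _ hx => exact ⟨hx.2, by rw [star_star]; exact hx.1⟩
  obtain ⟨v, hv, hv0⟩ := Submodule.exists_mem_ne_zero_of_ne_bot hW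
  obtain ⟨i, hi⟩ := Function.ne_iff.mp hv0
  refine eq_top_iff.mpr fun w _ => ?_
  -- This rank-one matrix sends `v` to the arbitrary vector `w`.
  have h1 := key (vecMulVec w (Pi.single i (v i)⁻¹)) v hv
  rw [vecMulVec_mulVec] at h1
  simpa [inv_mul_cancel₀ hi] using h1

theorem not_forall_isStarProjection_of_transpose_eq_neg (hd : d = 4 ∨ d = 6) (hm : m ≤ 3)
    {X : Fin m → Matrix (Fin d) (Fin d) ℂ} (hX : IsIrreducibleCollection X)
    {U : Matrix (Fin d) (Fin d) ℂ} (hU : IsUnit U) (hUT : Uᵀ = -U)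
    (h : ∀ j, U * X j = entryConj d (X j) * U) : ¬ ∀ j, IsStarProjection (X j) := by
  intro hproj
  have hherm : ∀ j, (X j)ᴴ = X j := fun j => (hproj j).isSelfAdjoint
  have h1 : ∀ j, ∃ P, IsPlaneProj U P ∧ (X j = P ∨ X j = 1 - P) := by
    intro j
    have hadj : U * X j = (X j)ᵀ * U := by
      rw [h j, entryConj_eq_transpose_conjTranspose, hherm j]
    rcases isPlaneProj_or_one_sub hU hUT (by omega) (hproj j).isIdempotentElem hadj with hP | hP
    · exact ⟨_, hP, .inl rfl⟩
    · exact ⟨_, hP, .inr (by simp)⟩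
  choose P hP hXP using h1
  -- Padding by zero, which is itself a plane projection, reduces to exactly three.
  let P' : Fin 3 → Matrix (Fin d) (Fin d) ℂ := fun i => if hi : i.1 < m then P ⟨i, hi⟩ else 0
  have hP' : ∀ i, IsPlaneProj U (P' i) := by
    intro i
    by_cases hi : i.1 < m
    · simp only [P', hi, dif_pos]; exact hP _
    · simp only [P', hi, dif_neg, not_false_iff]
      exact ⟨by simp, by simp, by simp⟩
  obtain ⟨W, hW0, hW3, hW⟩ :=
    hasSmallInvariantSubspace (by omega) hU hUT (hP' 0) (hP' 1) (hP' 2)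
  have hW' : ∀ i, ∀ w ∈ W, P' i *ᵥ w ∈ W := by
    intro i w hw
    fin_cases i
    exacts [(hW w hw).1, (hW w hw).2.1, (hW w hw).2.2]
  have hXW : ∀ j, ∀ w ∈ W, X j *ᵥ w ∈ W := by
    intro j w hw
    have h2 := hW' ⟨j, by omega⟩ w hw
    simp only [P', j.2, dif_pos] at h2
    rcases hXP j with h3 | h3
    · rwa [h3]
    · rw [h3, sub_mulVec, one_mulVec]
      exact W.sub_mem hw h2
  have htop := hX.eq_top_of_invariant hW0 hXW fun j => by rw [hherm j]; exact hXW j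
  rw [htop, finrank_top, Module.finrank_fin_fun] at hW3
  omega

theorem IsUnitarilySelfConj.isUnitarilyReal (hd : 0 < d)
    {X : Fin m → Matrix (Fin d) (Fin d) ℂ} (hX : IsIrreducibleCollection X)
    (hcase : Odd d ∨ (d = 2 ∧ ∀ j, (X j).IsHermitian) ∨
      ((d = 4 ∨ d = 6) ∧ m ≤ 3 ∧ ∀ j, IsStarProjection (X j)))
    (h : IsUnitarilySelfConj X) : IsUnitarilyReal X := by
  obtain ⟨U, hU, h⟩ := h
  have hunit : IsUnit U := ⟨⟨U, Uᴴ, self_mul_conjTranspose_of_mem_unitaryGroup hU,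
    conjTranspose_mul_self_of_mem_unitaryGroup hU⟩, rfl⟩
  have hdet : U.det ≠ 0 := ((isUnit_iff_isUnit_det U).mp hunit).ne_zero
  rcases transpose_eq_or_eq_neg hd hX hU h with hUT | hUT
  · exact isUnitarilyReal_of_transpose_eq_self hU h hUT
  · exfalso
    have h1 := fun j => entryConj_mul_eq_of_isUnitary hU (h j)
    rcases hcase with hodd | ⟨rfl, hherm⟩ | ⟨hd', hm, hproj⟩
    · exact not_odd_of_transpose_eq_neg hdet hUT (by rwa [Fintype.card_fin])
    · refine not_isHermitian_of_transpose_eq_neg hX hdet hUT (fun j => ?_) hherm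
      rw [h1 j, entryConj_eq_transpose_conjTranspose, hherm j]
    · exact not_forall_isStarProjection_of_transpose_eq_neg hd' hm hX hunit hUT h1 hproj

end Symplectic

theorem mainTheorem6 (d m : ℕ) (hd : 0 < d) (X : Fin m → Matrix (Fin d) (Fin d) ℂ)
    (hX : IsIrreducibleCollection X) :
    (IsUnitarilyReal X → IsUnitarilySelfConj X) ∧
    List.TFAE [IsUnitarilySelfConj X, HasRealTraces X, HasOnlyRealScalars X,
      realStarAlg X ≠ ⊤] ∧
    ((Odd d ∨ (d = 2 ∧ ∀ j, (X j).IsHermitian) ∨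
        ((d = 4 ∨ d = 6) ∧ m ≤ 3 ∧ ∀ j, IsStarProjection (X j))) →
      List.TFAE [IsUnitarilyReal X, IsUnitarilySelfConj X, HasRealTraces X,
        HasOnlyRealScalars X, realStarAlg X ≠ ⊤]) := by
  have htfae := tfae_isUnitarilySelfConj hd hX
  refine ⟨IsUnitarilyReal.isUnitarilySelfConj, htfae, fun hcase => ?_⟩
  exact List.tfae_cons_cons.mpr
    ⟨⟨IsUnitarilyReal.isUnitarilySelfConj, IsUnitarilySelfConj.isUnitarilyReal hd hX hcase⟩, htfae⟩
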